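/- Let $d = m+n$ with integers $m \ge 1$, $n \ge 0$, let $\Omega \subset \mathbb{R}^d$ be compact, and let $g, \varphi : \Omega \to \mathbb{R}$ be continuous and positive. Let $f(\omega) = \omega_1^{\kappa_1}\cdots\omega_d^{\kappa_d}\, g(\omega)$ with nonnegative integers $\kappa_i$, and suppose that $\kappa_1 = \cdots = \kappa_m = 1/\ell$ with $\ell > 0$, and $\kappa_j < 1/\ell$ for $m < j \le d$. Let $L = \{\omega \in \mathbb{R}^d : \omega_1 = \cdots = \omega_m = 0\}$, and write $\bar\omega = (\omega_{m+1},\dots,\omega_d)$. Suppose that $\partial\Omega$ is transversal to $L$ in the following sense: for each $x \in \partial\Omega \cap L$ there are finitely many $C^1$ functions $h_1,\dots,h_k$ defined near $x$, with $h_i(x) = 0$, $dh_i(x) \neq 0$ and $\ker dh_i(x) + L = \mathbb{R}^d$ for each $i$, such that $\partial\Omega \subset \bigcup_i \{h_i = 0\}$ in a neighborhood of $x$. (For a boundary that is a smooth hypersurface near $x$, this holds with $k=1$ if its tangent space at $x$ together with $L$ generates $\mathbb{R}^d$; several $h_i$ allow for corners.) Put $$V(\lambda) = \int_{\{\omega \in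 \Omega :\, |f(\omega)| \le \lambda\}} \varphi(\omega)\, d\omega, \qquad C = \frac{(2\ell)^m}{\ell\,(m-1)!} \int_{\Omega \cap L} \Big(\prod_{j=m+1}^{d} |\omega_j|^{-\ell\kappa_j}\Big)\, g(0,\dots,0,\bar\omega)^{-\ell}\, \varphi(0,\dots,0,\bar\omega)\, d\bar\omega,$$ where $d\omega$, $d\bar\omega$ are Lebesgue measures (for $n=0$, $d\bar\omega$ is the unit point mass). Then the integral in $C$ converges, and $$V(\lambda) = C\,\lambda^{\ell}(-\ln\lambda)^{m-1} + o\big(\lambda^{\ell}(-\ln\lambda)^{m-1}\big) \qquad (\lambda \to 0^+).$$ If moreover $L$ meets the interior of $\Omega$, then $C > 0$, and therefore $V(\lambda)/\big(C\lambda^\ell(-\ln\lambda)^{m-1}\big) \to 1$ as $\lambda \to 0^+$. -/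

import Mathlib

open Filter Topology MeasureTheory Asymptotics

/-- The linear subspace `L = {ω₁ = ⋯ = ωₘ = 0}` of `ℝ^(m+n)`. -/
def coordSubspace (m n : ℕ) : Submodule ℝ (Fin (m + n) → ℝ) where
  carrier := {ω | ∀ i : Fin m, ω (Fin.castAdd n i) = 0}
  add_mem' := by
    intro a b ha hb i
    have h1 := ha i
    have h2 := hb i
    simp [h1, h2]
  zero_mem' := by
    intro i
    rfl
  smul_mem' := by
    intro c a ha i
    have h1 := ha i
    simp [h1]

/-- The boundary of `Ω` is transversal to the subspace `L`: near each common point `x`, the boundary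
lies on finitely many `C¹` hypersurfaces `{h i = 0}` through `x`, each of which is smooth at `x`
(nonzero differential) and has a tangent space `ker (d (h i) x)` which together with `L` generates
the whole space. One hypersurface (`k = 1`) is the case of a boundary that is smooth at `x`; several
of them allow for edges and corners, as for a box. -/
def BoundaryTransversal {E : Type*} [NormedAddCommGroup E] [NormedSpace ℝ E]
    (Ω : Set E) (L : Submodule ℝ E) : Prop :=
  ∀ x ∈ frontier Ω, x ∈ L →
    ∃ (k : ℕ) (h : Fin k → E → ℝ),
      (∀ i, h i x = 0 ∧ ContDiffAt ℝ 1 (h i) x ∧ fderiv ℝ (h i) x ≠ 0 ∧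
        LinearMap.ker (fderiv ℝ (h i) x : E →ₗ[ℝ] ℝ) ⊔ L = ⊤) ∧
      ∀ᶠ y in 𝓝 x, y ∈ frontier Ω → ∃ i, h i y = 0

/-- The function `f(ω) = ω₁^κ₁ ⋯ ω_d^κ_d · g(ω)`. -/
def monomialTimes {d : ℕ} (κ : Fin d → ℕ) (g : (Fin d → ℝ) → ℝ) (ω : Fin d → ℝ) : ℝ :=
  (∏ i, ω i ^ κ i) * g ω

/-- `V(t)`, the integral of `φ` over `{ω ∈ Ω : |f(ω)| ≤ t}` with respect to Lebesgue measure. -/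
noncomputable def tubeVolume {d : ℕ} (Ω : Set (Fin d → ℝ)) (f φ : (Fin d → ℝ) → ℝ) (t : ℝ) : ℝ :=
  ∫ ω in {ω | ω ∈ Ω ∧ |f ω| ≤ t}, φ ω

/-- The set `Ω ∩ L`, as a subset of `ℝⁿ` in the coordinates `ω̄ = (ω_{m+1}, …, ω_{m+n})`. -/
def coordSlice (m n : ℕ) (Ω : Set (Fin (m + n) → ℝ)) : Set (Fin n → ℝ) :=
  {y | Fin.append (0 : Fin m → ℝ) y ∈ Ω}

/-- The function `|ω̄|^(-ℓκ̄) · g(0, ω̄)^(-ℓ) · φ(0, ω̄)` of `ω̄ ∈ ℝⁿ`. -/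
noncomputable def sliceIntegrand (m n : ℕ) (κ : Fin (m + n) → ℕ) (ℓ : ℝ)
    (g φ : (Fin (m + n) → ℝ) → ℝ) (y : Fin n → ℝ) : ℝ :=
  (∏ j : Fin n, |y j| ^ (-(ℓ * (κ (Fin.natAdd m j) : ℝ)))) *
    g (Fin.append (0 : Fin m → ℝ) y) ^ (-ℓ) * φ (Fin.append (0 : Fin m → ℝ) y)

/-- The constant `C`. For `n = 0` the integral is the value at the origin if `0 ∈ Ω`, and `0`
otherwise (Lebesgue measure on `ℝ⁰` is the unit point mass). -/
noncomputable def tubeConstant (m n : ℕ) (Ω : Set (Fin (m + n) → ℝ)) (κ : Fin (m + n) → ℕ) (ℓ : ℝ)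
    (g φ : (Fin (m + n) → ℝ) → ℝ) : ℝ :=
  (2 * ℓ) ^ m / (ℓ * (Nat.factorial (m - 1) : ℝ)) *
    ∫ y in coordSlice m n Ω, sliceIntegrand m n κ ℓ g φ y

/-!
Split `ω = (w, y)` with `w ∈ ℝ^m`, `y ∈ ℝⁿ`. By Fubini `V(t)` is the integral over `y` of
`∫ φ(w, y) dw` over those `w` with `(w, y) ∈ Ω` and `|w₁ ⋯ wₘ| ≤ (t / (a(y) g(w, y))) ^ ℓ`, where
`a(y) = ∏ |y_j| ^ κ_j`; here `κ₁ = ⋯ = κₘ = 1 / ℓ` is used.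

The model case is the volume of `{|w₁ ⋯ wₘ| ≤ s}` in the cube `[-r, r]^m`. Slicing along one
coordinate gives by induction the closed form `2^m s ∑_{j < m} log(r^m / s)^j / j!` for `s < r^m`
(`volume_real_boxTube`). Its leading term `2^m s (-log s)^(m-1) / (m-1)!` as `s → 0` does not depend
on `r` (`tendsto_volume_boxTube_div`), so in the limit all of the normalised volume sits at `w = 0`.
Hence, for fixed `y`, the fibre integral divided by `t^ℓ (-log t)^(m-1)` tends to
`2^m ℓ^(m-1) / (m-1)! * (a(y) g(0, y))^(-ℓ) φ(0, y)` if `(0, y)` is an interior point of `Ω`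
(`tendsto_setIntegral_weightedTube_of_mem`), and to `0` if `(0, y)` is outside `Ω`
(`tendsto_setIntegral_weightedTube_of_notMem`).

The closed form also bounds the normalised fibre integrals by a constant times
`∏ |y_j| ^ (-ℓ κ_j)` on a bounded set of `y`, which is integrable because `ℓ κ_j < 1`
(`exists_norm_setIntegral_tubeFibre_le`). Transversality says that near a common point the boundary
of `Ω` meets `L` in finitely many `C¹` hypersurfaces of `L`, so the remaining `y`, those with
`(0, y)` on the boundary, form a null set
(`BoundaryTransversal.volume_preimage_frontier_eq_zero`). Dominated convergence gives the limit `C`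
of `V(t) / (t^ℓ (-log t)^(m-1))` (`tendsto_tubeVolume_div`).
-/

/-! ### The volume of `{|w₁ ⋯ wₘ| ≤ s}` in a cube -/

/-- The part of the cube `[-r, r]^m` where the product of the coordinates is at most `s` in absolute
value. The cube is written as a ball of the sup norm. -/
def boxTube (m : ℕ) (r s : ℝ) : Set (Fin m → ℝ) :=
  {w | ‖w‖ ≤ r ∧ |∏ i, w i| ≤ s}

/-- The volume of `boxTube m r s` for `r, s > 0`, in closed form. -/
noncomputable def boxTubeVol (m : ℕ) (r s : ℝ) : ℝ :=
  if s < r ^ m then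
    2 ^ m * s * ∑ j ∈ Finset.range m, Real.log (r ^ m / s) ^ j / (Nat.factorial j : ℝ)
  else (2 * r) ^ m

theorem isClosed_boxTube (m : ℕ) (r s : ℝ) : IsClosed (boxTube m r s) :=
  (isClosed_le continuous_norm continuous_const).inter
    (isClosed_le (f := fun w : Fin m → ℝ => |∏ i, w i|) (by fun_prop) continuous_const)

theorem volume_boxTube_lt_top (m : ℕ) (r s : ℝ) : volume (boxTube m r s) < ⊤ :=
  lt_of_le_of_lt (measure_mono fun _ hw => mem_closedBall_zero_iff.2 hw.1)
    (measure_closedBall_lt_top (x := (0 : Fin m → ℝ)) (r := r))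

theorem boxTube_mono {m : ℕ} {r r' s s' : ℝ} (hr : r ≤ r') (hs : s ≤ s') :
    boxTube m r s ⊆ boxTube m r' s' :=
  fun _ hw => ⟨hw.1.trans hr, hw.2.trans hs⟩

theorem volume_real_boxTube_of_pow_le {m : ℕ} {r s : ℝ} (hr : 0 < r) (hs : r ^ m ≤ s) :
    volume.real (boxTube m r s) = (2 * r) ^ m := by
  have h : boxTube m r s = Metric.closedBall 0 r := by
    ext w
    simp only [boxTube, Set.mem_ofPred_eq, mem_closedBall_zero_iff, and_iff_left_iff_imp]
    intro hw
    refine le_trans ?_ hs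
    rw [Finset.abs_prod]
    calc ∏ i, |w i| ≤ ∏ _i : Fin m, r :=
          Finset.prod_le_prod (fun _ _ => abs_nonneg _) fun i _ => (norm_le_pi_norm w i).trans hw
      _ = r ^ m := by simp
  rw [h, Measure.real, Real.volume_pi_closedBall _ hr.le, ENNReal.toReal_ofReal (by positivity)]
  simp

/-- Slicing along the first coordinate: the slice of the tube at height `t` is a tube with
parameter `s / |t|`. -/
theorem volume_real_boxTube_succ (m : ℕ) {r : ℝ} (hr : 0 < r) (s : ℝ) :
    volume.real (boxTube (m + 1) r s) =
      2 * ∫ t in (0)..r, volume.real (boxTube m r (s / t)) := by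
  set e := MeasurableEquiv.piFinSuccAbove (fun _ : Fin (m + 1) => ℝ) 0
  have he : MeasurePreserving e := volume_preserving_piFinSuccAbove (fun _ => ℝ) 0
  have h1 : volume.real (boxTube (m + 1) r s) =
      volume.real (e.symm ⁻¹' boxTube (m + 1) r s) := by
    rw [Measure.real, Measure.real, (he.symm e).measure_preimage_equiv]
  have hms : MeasurableSet (e.symm ⁻¹' boxTube (m + 1) r s) :=
    e.symm.measurable (isClosed_boxTube _ _ _).measurableSet
  have hslice : ∀ t : ℝ, t ≠ 0 → Prod.mk t ⁻¹' (e.symm ⁻¹' boxTube (m + 1) r s) =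
      if |t| ≤ r then boxTube m r (s / |t|) else ∅ := by
    intro t ht
    have ht' : 0 < |t| := abs_pos.2 ht
    ext w
    have hn : ‖e.symm (t, w)‖ ≤ r ↔ |t| ≤ r ∧ ‖w‖ ≤ r := by
      simp [e, pi_norm_le_iff_of_nonneg hr.le, Fin.forall_fin_succ, MeasurableEquiv.piFinSuccAbove]
    have hp : |∏ i, e.symm (t, w) i| ≤ s ↔ |∏ i, w i| ≤ s / |t| := by
      rw [le_div_iff₀ ht', mul_comm, ← abs_mul]
      simp [e, Fin.prod_univ_succ, MeasurableEquiv.piFinSuccAbove]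
    simp only [Set.mem_preimage, boxTube, Set.mem_ofPred_eq, hn, hp]
    split_ifs with h <;> simp [h]
  have hfin : ∀ᵐ t : ℝ, volume (Prod.mk t ⁻¹' (e.symm ⁻¹' boxTube (m + 1) r s)) < ⊤ := by
    filter_upwards [Measure.ae_ne volume (0 : ℝ)] with t ht
    rw [hslice t ht]
    split_ifs
    · exact volume_boxTube_lt_top _ _ _
    · simp
  rw [h1, Measure.real, Measure.volume_eq_prod, Measure.prod_apply hms,
    ← integral_toReal (measurable_measure_prodMk_left hms).aemeasurable hfin]
  have h2 : ∫ t : ℝ, (volume (Prod.mk t ⁻¹' (e.symm ⁻¹' boxTube (m + 1) r s))).toReal =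
      ∫ t : ℝ, (Set.Iic r).indicator (fun t => volume.real (boxTube m r (s / t))) |t| := by
    refine integral_congr_ae ?_
    filter_upwards [Measure.ae_ne volume (0 : ℝ)] with t ht
    rw [hslice t ht]
    by_cases h : |t| ≤ r <;> simp [h, Measure.real]
  rw [h2, integral_comp_abs, setIntegral_indicator measurableSet_Iic, Set.Ioi_inter_Iic,
    intervalIntegral.integral_of_le hr.le]

theorem volume_real_boxTube (m : ℕ) {r s : ℝ} (hr : 0 < r) (hs : 0 < s) :
    volume.real (boxTube m r s) = boxTubeVol m r s := by
  induction m generalizing s with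
  | zero =>
    unfold boxTubeVol
    split_ifs with h
    · have : boxTube 0 r s = ∅ := by
        ext w
        simp only [boxTube, Finset.univ_eq_empty, Finset.prod_empty, abs_one, Set.mem_ofPred_eq,
          Set.mem_empty_iff_false, iff_false, not_and, not_le]
        simpa using fun _ => h
      simp [this]
    · exact volume_real_boxTube_of_pow_le hr (not_lt.1 h)
  | succ m ih =>
    by_cases h : s < r ^ (m + 1)
    swap
    · rw [volume_real_boxTube_of_pow_le hr (not_lt.1 h), boxTubeVol, if_neg h]
    rw [volume_real_boxTube_succ m hr, boxTubeVol, if_pos h]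
    -- below height `c` the slice is the whole cube
    set c := s / r ^ m with hc
    have hrm : 0 < r ^ m := by positivity
    have hc0 : 0 < c := by positivity
    have hcr : c < r := by rw [hc, div_lt_iff₀ hrm]; rwa [pow_succ, mul_comm] at h
    have e1 : Set.EqOn (fun t => volume.real (boxTube m r (s / t))) (fun _ => (2 * r) ^ m)
        (Set.uIoc 0 c) := by
      intro t ht
      rw [Set.uIoc_of_le hc0.le] at ht
      refine volume_real_boxTube_of_pow_le hr ?_
      rw [le_div_iff₀ ht.1, mul_comm, ← le_div_iff₀ hrm]
      exact ht.2
    set F : ℝ → ℝ := fun t => 2 ^ m * (s / t) *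
      ∑ j ∈ Finset.range m, Real.log (r ^ m / (s / t)) ^ j / (Nat.factorial j : ℝ) with hF
    have e2 : Set.EqOn (fun t => volume.real (boxTube m r (s / t))) F (Set.uIoc c r) := by
      intro t ht
      rw [Set.uIoc_of_le hcr.le] at ht
      have ht0 := hc0.trans ht.1
      have : s / t < r ^ m := by
        rw [div_lt_iff₀ ht0, mul_comm, ← div_lt_iff₀ hrm]
        exact ht.1
      simp only [hF]
      rw [ih (by positivity), boxTubeVol, if_pos this]
    -- an antiderivative of `F`
    set G : ℝ → ℝ := fun t => 2 ^ m * s *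
      ∑ j ∈ Finset.range m, Real.log (r ^ m / (s / t)) ^ (j + 1) / (Nat.factorial (j + 1) : ℝ)
      with hG
    have hpos : ∀ t ∈ Set.uIcc c r, 0 < t := fun t ht => by
      rw [Set.uIcc_of_le hcr.le] at ht
      exact hc0.trans_le ht.1
    have hlog : ∀ t, 0 < t →
        HasDerivAt (fun t => Real.log (r ^ m / (s / t))) (1 / t) t := by
      intro t ht
      have h1 : HasDerivAt (fun t : ℝ => r ^ m / s * t) (r ^ m / s) t := by
        simpa using (hasDerivAt_id t).const_mul (r ^ m / s)
      have h2 := h1.log (by positivity)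
      have h3 : (fun t : ℝ => Real.log (r ^ m / (s / t))) = fun t => Real.log (r ^ m / s * t) := by
        ext t
        rw [div_div_eq_mul_div, div_mul_eq_mul_div]
      rw [h3]
      convert! h2 using 1
      field_simp
    have hderiv : ∀ t ∈ Set.uIcc c r, HasDerivAt G (F t) t := by
      intro t ht
      have ht0 := hpos t ht
      have := (HasDerivAt.fun_sum (u := Finset.range m) fun j _ =>
        ((hlog t ht0).pow (j + 1)).div_const (Nat.factorial (j + 1) : ℝ)).const_mul (2 ^ m * s)
      refine this.congr_deriv ?_
      simp only [hF]
      rw [Finset.mul_sum, Finset.mul_sum]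
      refine Finset.sum_congr rfl fun j _ => ?_
      rw [Nat.factorial_succ]
      push_cast
      field_simp
    have hFc : ContinuousOn F (Set.uIcc c r) := by
      intro t ht
      have ht0 := hpos t ht
      refine ContinuousAt.continuousWithinAt ?_
      have := (hlog t ht0).continuousAt
      simp only [hF]
      refine ContinuousAt.mul ?_ ?_
      · exact continuousAt_const.mul (continuousAt_const.div continuousAt_id ht0.ne')
      · exact tendsto_finsetSum _ fun j _ => (this.pow j).div_const _
    have i1 : IntervalIntegrable (fun t => volume.real (boxTube m r (s / t))) volume 0 c :=
      (intervalIntegrable_congr e1).2 (by simp)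
    have i2 : IntervalIntegrable (fun t => volume.real (boxTube m r (s / t))) volume c r :=
      (intervalIntegrable_congr e2).2 hFc.intervalIntegrable
    rw [← intervalIntegral.integral_add_adjacent_intervals i1 i2,
      intervalIntegral.integral_congr_ae (ae_of_all _ fun t ht => e1 ht),
      intervalIntegral.integral_congr_ae (ae_of_all _ fun t ht => e2 ht),
      intervalIntegral.integral_eq_sub_of_hasDerivAt hderiv hFc.intervalIntegrable,
      Finset.sum_range_succ']
    have hc1 : r ^ m / (s / c) = 1 := by rw [hc]; field_simp
    have hr1 : r ^ m / (s / r) = r ^ (m + 1) / s := by rw [pow_succ]; field_simp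
    simp only [hG, hc1, hr1, Real.log_one, intervalIntegral.integral_const, smul_eq_mul]
    simp only [ne_eq, Nat.add_eq_zero_iff, one_ne_zero, and_false, not_false_eq_true, zero_pow,
      zero_div, Finset.sum_const_zero, mul_zero, sub_zero, pow_zero, Nat.factorial_zero,
      Nat.cast_one, div_one]
    have : c * (2 * r) ^ m = 2 ^ m * s := by rw [hc]; field_simp; ring
    rw [this]
    ring

/-! ### Asymptotics of tube volumes and a uniform bound -/

/-- The scale `t ^ ℓ * (-log t) ^ (m - 1)` to which tube volumes are compared. -/
noncomputable def tubeScale (m : ℕ) (ℓ t : ℝ) : ℝ := t ^ ℓ * (-Real.log t) ^ (m - 1)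

theorem tubeScale_pos (m : ℕ) (ℓ : ℝ) {t : ℝ} (h0 : 0 < t) (h1 : t < 1) : 0 < tubeScale m ℓ t :=
  mul_pos (Real.rpow_pos_of_pos h0 _) (pow_pos (neg_pos.2 (Real.log_neg h0 h1)) _)

theorem eventually_tubeScale_pos (m : ℕ) (ℓ : ℝ) : ∀ᶠ t in 𝓝[>] (0 : ℝ), 0 < tubeScale m ℓ t := by
  filter_upwards [Ioo_mem_nhdsGT (zero_lt_one' ℝ)] with t ht using tubeScale_pos m ℓ ht.1 ht.2

theorem log_pow_div_mul_rpow (m : ℕ) {r c t : ℝ} (ℓ : ℝ) (hr : 0 < r) (hc : 0 < c) (ht : 0 < t) :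
    Real.log (r ^ m / (c * t) ^ ℓ) = (m * Real.log r - ℓ * Real.log c) + ℓ * -Real.log t := by
  rw [Real.log_div (by positivity) (by positivity), Real.log_pow, Real.log_rpow (by positivity),
    Real.log_mul hc.ne' ht.ne']
  ring

theorem tendsto_neg_log_nhdsGT_zero : Tendsto (fun t => -Real.log t) (𝓝[>] 0) atTop :=
  tendsto_neg_atBot_atTop.comp Real.tendsto_log_nhdsGT_zero

theorem tendsto_affine_pow_div_pow (A b : ℝ) {j k : ℕ} (hjk : j ≤ k) :
    Tendsto (fun x : ℝ => (A + b * x) ^ j / x ^ k) atTop (𝓝 (if j = k then b ^ k else 0)) := by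
  have h1 : Tendsto (fun x : ℝ => A / x + b) atTop (𝓝 b) := by
    simpa using (tendsto_const_nhds.div_atTop tendsto_id (a := A)).add_const b
  have h2 : Tendsto (fun x : ℝ => (A / x + b) ^ j * (x⁻¹) ^ (k - j)) atTop
      (𝓝 (b ^ j * 0 ^ (k - j))) := (h1.pow j).mul (tendsto_inv_atTop_zero.pow _)
  have h3 : b ^ j * 0 ^ (k - j) = if j = k then b ^ k else 0 := by
    split_ifs with h
    · simp [h]
    · rw [zero_pow (by omega), mul_zero]
  rw [h3] at h2
  refine h2.congr' ?_
  filter_upwards [eventually_gt_atTop 0] with x hx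
  obtain ⟨i, rfl⟩ := Nat.exists_eq_add_of_le hjk
  rw [Nat.add_sub_cancel_left, pow_add]
  have : A / x + b = (A + b * x) / x := by field_simp
  rw [this, div_pow, inv_pow]
  field_simp

/-- The limit does not depend on the size `r` of the cube, so the volume of the tube concentrates
at the origin. -/
theorem tendsto_volume_boxTube_div {m : ℕ} (hm : 1 ≤ m) {ℓ r c : ℝ} (hℓ : 0 < ℓ) (hr : 0 < r)
    (hc : 0 < c) :
    Tendsto (fun t => volume.real (boxTube m r ((c * t) ^ ℓ)) / tubeScale m ℓ t) (𝓝[>] 0)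
      (𝓝 (2 ^ m * ℓ ^ (m - 1) / ((m - 1).factorial : ℝ) * c ^ ℓ)) := by
  set A : ℝ := m * Real.log r - ℓ * Real.log c
  have hsum : Tendsto (fun x : ℝ => 2 ^ m * c ^ ℓ * ∑ j ∈ Finset.range m,
      (A + ℓ * x) ^ j / x ^ (m - 1) / (j.factorial : ℝ)) atTop
      (𝓝 (2 ^ m * c ^ ℓ * ∑ j ∈ Finset.range m,
        (if j = m - 1 then ℓ ^ (m - 1) else 0) / (j.factorial : ℝ))) := by
    refine Tendsto.const_mul _ (tendsto_finsetSum _ fun j hj => ?_)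
    have := Finset.mem_range.1 hj
    exact (tendsto_affine_pow_div_pow A ℓ (by omega)).div_const _
  have hlim : 2 ^ m * c ^ ℓ * ∑ j ∈ Finset.range m,
      (if j = m - 1 then ℓ ^ (m - 1) else 0) / (j.factorial : ℝ) =
      2 ^ m * ℓ ^ (m - 1) / ((m - 1).factorial : ℝ) * c ^ ℓ := by
    simp only [ite_div, zero_div, Finset.sum_ite_eq', Finset.mem_range]
    rw [if_pos (by omega)]
    ring
  rw [hlim] at hsum
  refine (hsum.comp tendsto_neg_log_nhdsGT_zero).congr' ?_
  have hsmall : ∀ᶠ t in 𝓝[>] (0 : ℝ), (c * t) ^ ℓ < r ^ m := by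
    have : Tendsto (fun t : ℝ => (c * t) ^ ℓ) (𝓝[>] 0) (𝓝 0) := by
      have h : ContinuousAt (fun t : ℝ => (c * t) ^ ℓ) 0 :=
        (continuousAt_const.mul continuousAt_id).rpow_const (Or.inr hℓ.le)
      have h' := h.tendsto
      simp only [mul_zero, Real.zero_rpow hℓ.ne'] at h'
      exact h'.mono_left nhdsWithin_le_nhds
    exact this.eventually_lt_const (by positivity)
  filter_upwards [hsmall, Ioo_mem_nhdsGT (zero_lt_one' ℝ)] with t ht ht'
  have ht0 := ht'.1
  rw [volume_real_boxTube m hr (by positivity), boxTubeVol, if_pos ht,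
    log_pow_div_mul_rpow m ℓ hr hc ht0, show m * Real.log r - ℓ * Real.log c = A from rfl,
    tubeScale, Real.mul_rpow hc.le ht0.le]
  have hx : 0 < -Real.log t := neg_pos.2 (Real.log_neg ht0 ht'.2)
  simp only [Function.comp]
  rw [Finset.mul_sum, Finset.mul_sum, Finset.sum_div]
  refine Finset.sum_congr rfl fun j _ => ?_
  have := Real.rpow_pos_of_pos ht0 ℓ
  field_simp

/-- A bound of the expected order that is uniform in `c ≥ c₀`; it also covers the parameters `c` so
large that the tube is the whole cube. -/
theorem volume_boxTube_le {m : ℕ} (hm : 1 ≤ m) {ℓ r c₀ : ℝ} (hℓ : 0 < ℓ) (hr : 0 < r)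
    (hc₀ : 0 < c₀) :
    ∃ K, 0 ≤ K ∧ ∀ᶠ t in 𝓝[>] (0 : ℝ), ∀ c, c₀ ≤ c →
      volume.real (boxTube m r ((c * t) ^ ℓ)) ≤ K * c ^ ℓ * tubeScale m ℓ t := by
  set A : ℝ := m * Real.log r - ℓ * Real.log c₀
  -- `B` is chosen so that `A + ℓ * x ≤ B * x` for `x = -log t ≥ 1`
  set B : ℝ := |A| + ℓ + 1
  have hB : 1 ≤ B := by have := abs_nonneg A; simp only [B]; linarith
  refine ⟨2 ^ m * (m * B ^ (m - 1)), by positivity, ?_⟩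
  filter_upwards [tendsto_neg_log_nhdsGT_zero.eventually_ge_atTop 1, self_mem_nhdsWithin]
    with t hx ht0 c hc
  replace ht0 : 0 < t := ht0
  have hc0 := hc₀.trans_le hc
  rw [volume_real_boxTube m hr (by positivity), boxTubeVol, tubeScale]
  set x := -Real.log t
  have hbase : 2 ^ m * (c * t) ^ ℓ * (m * (B * x) ^ (m - 1)) =
      2 ^ m * (m * B ^ (m - 1)) * c ^ ℓ * (t ^ ℓ * x ^ (m - 1)) := by
    rw [Real.mul_rpow hc0.le ht0.le, mul_pow]
    ring
  rw [← hbase]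
  have hBx : 1 ≤ B * x := one_le_mul_of_one_le_of_one_le hB hx
  split_ifs with h
  · rw [log_pow_div_mul_rpow m ℓ hr hc0 ht0]
    have hL0 : 0 ≤ (m * Real.log r - ℓ * Real.log c) + ℓ * x := by
      rw [← log_pow_div_mul_rpow m ℓ hr hc0 ht0]
      exact Real.log_nonneg ((one_le_div (by positivity)).2 h.le)
    have hL : (m * Real.log r - ℓ * Real.log c) + ℓ * x ≤ B * x := by
      have h1 : ℓ * Real.log c₀ ≤ ℓ * Real.log c :=
        mul_le_mul_of_nonneg_left (Real.log_le_log hc₀ hc) hℓ.le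
      have h2 : A ≤ |A| * x := (le_abs_self A).trans (le_mul_of_one_le_right (abs_nonneg _) hx)
      simp only [B]
      simp only [A] at h2 ⊢
      nlinarith
    gcongr
    calc ∑ j ∈ Finset.range m, ((m * Real.log r - ℓ * Real.log c) + ℓ * x) ^ j / (j.factorial : ℝ)
        ≤ ∑ _j ∈ Finset.range m, (B * x) ^ (m - 1) := by
          refine Finset.sum_le_sum fun j hj => ?_
          have := Finset.mem_range.1 hj
          calc _ ≤ ((m * Real.log r - ℓ * Real.log c) + ℓ * x) ^ j :=
                div_le_self (pow_nonneg hL0 _) (by exact_mod_cast j.factorial_pos)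
            _ ≤ (B * x) ^ j := pow_le_pow_left₀ hL0 hL _
            _ ≤ (B * x) ^ (m - 1) := pow_le_pow_right₀ hBx (by omega)
      _ = m * (B * x) ^ (m - 1) := by simp
  · have h1 : (1 : ℝ) ≤ m * (B * x) ^ (m - 1) :=
      one_le_mul_of_one_le_of_one_le (by exact_mod_cast hm) (one_le_pow₀ hBx)
    rw [mul_pow]
    calc (2 : ℝ) ^ m * r ^ m ≤ 2 ^ m * (c * t) ^ ℓ := by gcongr; exact not_lt.1 h
      _ ≤ _ := le_mul_of_one_le_right (by positivity) h1

/-! ### The boundary meets `L` in a null set -/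

/-- The zero set of a `C¹` function is Lebesgue null near a point where the differential does not
vanish. The map `y ↦ y + (H y - dH y) • v` with `dH v = 1` is close to the identity, hence shrinks
volumes by at most a factor of `2`, and it sends the zero set into the hyperplane `ker dH`. -/
theorem exists_nhds_volume_inter_zeros_eq_zero {E : Type*} [NormedAddCommGroup E]
    [NormedSpace ℝ E] [FiniteDimensional ℝ E] [MeasurableSpace E] [BorelSpace E] (μ : Measure E)
    [μ.IsAddHaarMeasure] {H : E → ℝ} {x : E} (hH : ContDiffAt ℝ 1 H x) (h0 : fderiv ℝ H x ≠ 0) :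
    ∃ U ∈ 𝓝 x, μ (U ∩ {y | H y = 0}) = 0 := by
  set D := fderiv ℝ H x
  obtain ⟨v, hv⟩ : ∃ v, D v = 1 := by
    obtain ⟨u, hu⟩ : ∃ u, D u ≠ 0 := by
      by_contra! h
      exact h0 (ContinuousLinearMap.ext h)
    exact ⟨(D u)⁻¹ • u, by simp [hu]⟩
  set T : E → E := fun y => y + (H y - D y) • v
  have hT : HasStrictFDerivAt T (ContinuousLinearMap.id ℝ E) x := by
    have h1 : HasStrictFDerivAt H D x := hH.hasStrictFDerivAt one_ne_zero
    have h2 := (hasStrictFDerivAt_id (𝕜 := ℝ) x).add ((h1.sub D.hasStrictFDerivAt).smul_const v)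
    refine h2.congr_fderiv ?_
    ext
    simp
  have hdet := mul_le_addHaar_image_of_lt_det μ (ContinuousLinearMap.id ℝ E)
    (m := 1 / 2) (by simp [ContinuousLinearMap.det])
  obtain ⟨δ, hδ, hδ0⟩ := (hdet.and self_mem_nhdsWithin).exists
  obtain ⟨U, hU, hTU⟩ := hT.approximates_deriv_on_nhds (c := δ) (Or.inr hδ0)
  refine ⟨U, hU, ?_⟩
  have h3 := hδ _ T (hTU.mono_set (Set.inter_subset_left (t := {y | H y = 0})))
  have h4 : μ (T '' (U ∩ {y | H y = 0})) = 0 := by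
    refine measure_mono_null (t := (LinearMap.ker (D : E →ₗ[ℝ] ℝ) : Set E)) ?_
      (Measure.addHaar_submodule μ _ ?_)
    · rintro _ ⟨y, ⟨-, hy⟩, rfl⟩
      have hy' : H y = 0 := hy
      simp [T, hy', hv]
    · intro h
      have : v ∈ LinearMap.ker (D : E →ₗ[ℝ] ℝ) := h ▸ Submodule.mem_top
      simp [hv] at this
  rw [h4, nonpos_iff_eq_zero, mul_eq_zero] at h3
  exact h3.resolve_left (by simp)

/-- The embedding `ȳ ↦ (0, ȳ)` of `ℝⁿ` onto `L`. -/
noncomputable def zeroAppend (m n : ℕ) : (Fin n → ℝ) →L[ℝ] (Fin (m + n) → ℝ) :=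
  LinearMap.toContinuousLinearMap
    { toFun := fun y => Fin.append (0 : Fin m → ℝ) y
      map_add' := fun a b => by
        ext i
        refine Fin.addCases (fun i => ?_) (fun i => ?_) i <;> simp
      map_smul' := fun a b => by
        ext i
        refine Fin.addCases (fun i => ?_) (fun i => ?_) i <;> simp }

theorem zeroAppend_apply (m n : ℕ) (y : Fin n → ℝ) : zeroAppend m n y = Fin.append 0 y := rfl

theorem zeroAppend_mem (m n : ℕ) (y : Fin n → ℝ) : zeroAppend m n y ∈ coordSubspace m n :=
  fun i => by simp [zeroAppend_apply]

theorem exists_zeroAppend_eq {m n : ℕ} {x : Fin (m + n) → ℝ} (hx : x ∈ coordSubspace m n) :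
    ∃ y, zeroAppend m n y = x := by
  refine ⟨fun j => x (Fin.natAdd m j), ?_⟩
  ext i
  refine Fin.addCases (fun i => ?_) (fun i => ?_) i
  · rw [zeroAppend_apply, Fin.append_left, hx i]; rfl
  · rw [zeroAppend_apply, Fin.append_right]

/-- Transversality is used only through this consequence. -/
theorem BoundaryTransversal.volume_preimage_frontier_eq_zero {m n : ℕ}
    {Ω : Set (Fin (m + n) → ℝ)} (h : BoundaryTransversal Ω (coordSubspace m n)) :
    volume {y | zeroAppend m n y ∈ frontier Ω} = 0 := by
  refine measure_null_of_locally_null _ fun y hy => ?_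
  obtain ⟨k, H, hH, hcov⟩ := h _ hy (zeroAppend_mem m n y)
  have hloc : ∀ i, ∃ U ∈ 𝓝 y, volume (U ∩ {z | H i (zeroAppend m n z) = 0}) = 0 := by
    intro i
    obtain ⟨-, hC, hne, hsup⟩ := hH i
    refine exists_nhds_volume_inter_zeros_eq_zero volume
      (H := fun z => H i (zeroAppend m n z)) (hC.comp y (zeroAppend m n).contDiff.contDiffAt) ?_
    have hd : fderiv ℝ (fun z => H i (zeroAppend m n z)) y =
        (fderiv ℝ (H i) (zeroAppend m n y)).comp (zeroAppend m n) :=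
      ((hC.differentiableAt one_ne_zero).hasFDerivAt.comp y (zeroAppend m n).hasFDerivAt).fderiv
    intro h0
    rw [hd] at h0
    -- otherwise `L` lies in the kernel, which is then the whole space
    have hle : coordSubspace m n ≤
        LinearMap.ker (fderiv ℝ (H i) (zeroAppend m n y) : (Fin (m + n) → ℝ) →ₗ[ℝ] ℝ) := by
      intro x hx
      obtain ⟨z, rfl⟩ := exists_zeroAppend_eq hx
      exact DFunLike.congr_fun h0 z
    rw [sup_eq_left.2 hle] at hsup
    refine hne (ContinuousLinearMap.ext fun z => ?_)
    have : z ∈ LinearMap.ker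
      (fderiv ℝ (H i) (zeroAppend m n y) : (Fin (m + n) → ℝ) →ₗ[ℝ] ℝ) := hsup ▸ Submodule.mem_top
    exact this
  choose U hU hU0 using hloc
  have hV : {z | zeroAppend m n z ∈ frontier Ω → ∃ i, H i (zeroAppend m n z) = 0} ∈ 𝓝 y :=
    (zeroAppend m n).continuous.continuousAt.eventually hcov
  refine ⟨_, inter_mem_nhdsWithin _ (inter_mem hV (iInter_mem.2 hU)), ?_⟩
  refine measure_mono_null ?_ (measure_iUnion_null hU0)
  rintro z ⟨hz, hzV, hzU⟩
  obtain ⟨i, hi⟩ := hzV hz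
  exact Set.mem_iUnion.2 ⟨i, Set.mem_iInter.1 hzU i, hi⟩

/-! ### Tubes with a variable weight -/

/-- The limit of `volume (boxTube m r (t ^ ℓ)) / tubeScale m ℓ t` as `t → 0+`. -/
noncomputable def tubeCoeff (m : ℕ) (ℓ : ℝ) : ℝ := 2 ^ m * ℓ ^ (m - 1) / ((m - 1).factorial : ℝ)

/-- The part of `S ⊆ ℝ^m` where the product `P` of the coordinates satisfies
`γ * |P| ^ (1 / ℓ) ≤ t`, the inequality being solved for `|P|`. -/
def weightedTube {m : ℕ} (S : Set (Fin m → ℝ)) (γ : (Fin m → ℝ) → ℝ) (ℓ t : ℝ) :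
    Set (Fin m → ℝ) :=
  {w | w ∈ S ∧ |∏ i, w i| ≤ ((γ w)⁻¹ * t) ^ ℓ}

section WeightedTube

variable {m : ℕ} {S : Set (Fin m → ℝ)} {γ ψ : (Fin m → ℝ) → ℝ} {ℓ R γ₀ M : ℝ}

theorem weightedTube_subset_boxTube (hℓ : 0 < ℓ) (hSR : ∀ w ∈ S, ‖w‖ ≤ R) (hγ₀ : 0 < γ₀)
    (hγ : ∀ w ∈ S, γ₀ ≤ γ w) {t : ℝ} (ht : 0 < t) :
    weightedTube S γ ℓ t ⊆ boxTube m R ((γ₀⁻¹ * t) ^ ℓ) := by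
  rintro w ⟨hw, hwt⟩
  refine ⟨hSR w hw, hwt.trans ?_⟩
  have := hγ w hw
  have := hγ₀.trans_le this
  gcongr

theorem norm_setIntegral_weightedTube_le (hℓ : 0 < ℓ) (hSR : ∀ w ∈ S, ‖w‖ ≤ R) (hγ₀ : 0 < γ₀)
    (hγ : ∀ w ∈ S, γ₀ ≤ γ w) (hM : 0 ≤ M) (hψ : ∀ w ∈ S, ‖ψ w‖ ≤ M) {t : ℝ} (ht : 0 < t) :
    ‖∫ w in weightedTube S γ ℓ t, ψ w‖ ≤ M * volume.real (boxTube m R ((γ₀⁻¹ * t) ^ ℓ)) := by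
  have hsub := weightedTube_subset_boxTube hℓ hSR hγ₀ hγ ht
  refine (norm_setIntegral_le_of_norm_le_const
    ((measure_mono hsub).trans_lt (volume_boxTube_lt_top _ _ _)) fun w hw => hψ w hw.1).trans ?_
  exact mul_le_mul_of_nonneg_left
    (measureReal_mono hsub (volume_boxTube_lt_top _ _ _).ne) hM

/-- The part of the tube at distance more than `r` from the origin is negligible. -/
theorem tendsto_setIntegral_weightedTube_diff (hm : 1 ≤ m) (hℓ : 0 < ℓ)
    (hSR : ∀ w ∈ S, ‖w‖ ≤ R) (hγ₀ : 0 < γ₀) (hγ : ∀ w ∈ S, γ₀ ≤ γ w)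
    (hM : 0 ≤ M) (hψ : ∀ w ∈ S, ‖ψ w‖ ≤ M) {r : ℝ} (hr : 0 < r) (hrR : r ≤ R) :
    Tendsto (fun t => (∫ w in weightedTube S γ ℓ t \ Metric.closedBall 0 r, ψ w) / tubeScale m ℓ t)
      (𝓝[>] 0) (𝓝 0) := by
  have hc : 0 < γ₀⁻¹ := inv_pos.2 hγ₀
  have h0 : Tendsto (fun t => M * (volume.real (boxTube m R ((γ₀⁻¹ * t) ^ ℓ)) / tubeScale m ℓ t -
      volume.real (boxTube m r ((γ₀⁻¹ * t) ^ ℓ)) / tubeScale m ℓ t)) (𝓝[>] 0) (𝓝 0) := by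
    simpa using ((tendsto_volume_boxTube_div hm hℓ (hr.trans_le hrR) hc).sub
      (tendsto_volume_boxTube_div hm hℓ hr hc)).const_mul M
  refine squeeze_zero_norm' ?_ h0
  filter_upwards [eventually_tubeScale_pos m ℓ, self_mem_nhdsWithin] with t hN ht
  rw [norm_div, Real.norm_of_nonneg hN.le, ← sub_div, ← mul_div_assoc]
  gcongr
  set s := (γ₀⁻¹ * t) ^ ℓ
  have hsub : weightedTube S γ ℓ t \ Metric.closedBall 0 r ⊆ boxTube m R s \ boxTube m r s :=
    fun w hw => ⟨weightedTube_subset_boxTube hℓ hSR hγ₀ hγ ht hw.1,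
      fun h => hw.2 (mem_closedBall_zero_iff.2 h.1)⟩
  have hfin : volume (boxTube m R s \ boxTube m r s) < ⊤ :=
    (measure_mono Set.sdiff_subset).trans_lt (volume_boxTube_lt_top _ _ _)
  rw [← measureReal_sdiff (boxTube_mono hrR le_rfl) (isClosed_boxTube _ _ _).measurableSet
    (volume_boxTube_lt_top _ _ _).ne]
  refine (norm_setIntegral_le_of_norm_le_const ((measure_mono hsub).trans_lt hfin)
    fun w hw => hψ w hw.1.1).trans ?_
  exact mul_le_mul_of_nonneg_left (measureReal_mono hsub hfin.ne) hM

theorem tendsto_setIntegral_weightedTube_of_notMem (hm : 1 ≤ m) (hℓ : 0 < ℓ)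
    (hSR : ∀ w ∈ S, ‖w‖ ≤ R) (hR : 0 < R) (hγ₀ : 0 < γ₀) (hγ : ∀ w ∈ S, γ₀ ≤ γ w)
    (hM : 0 ≤ M) (hψ : ∀ w ∈ S, ‖ψ w‖ ≤ M) (hS : Sᶜ ∈ 𝓝 0) :
    Tendsto (fun t => (∫ w in weightedTube S γ ℓ t, ψ w) / tubeScale m ℓ t) (𝓝[>] 0) (𝓝 0) := by
  obtain ⟨r, hr, hrS⟩ := Metric.nhds_basis_closedBall.mem_iff.1 hS
  have h := tendsto_setIntegral_weightedTube_diff hm hℓ hSR hγ₀ hγ hM hψ (lt_min hr hR)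
    (min_le_right r R)
  refine h.congr fun t => ?_
  have : weightedTube S γ ℓ t \ Metric.closedBall 0 (min r R) = weightedTube S γ ℓ t :=
    sdiff_eq_left.2 <| Set.disjoint_left.2 fun w hw hwr =>
      hrS (Metric.closedBall_subset_closedBall (min_le_left r R) hwr) hw.1
  rw [this]

/-- Near the origin `γ` and `ψ` are almost constant, so there the tube lies between two tubes of
constant weight. -/
theorem tendsto_setIntegral_weightedTube_of_mem (hm : 1 ≤ m) (hℓ : 0 < ℓ)
    (hSR : ∀ w ∈ S, ‖w‖ ≤ R) (hR : 0 < R) (hγ₀ : 0 < γ₀) (hγ : ∀ w ∈ S, γ₀ ≤ γ w)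
    (hM : 0 ≤ M) (hψ : ∀ w ∈ S, ‖ψ w‖ ≤ M) (hψ0 : ∀ w ∈ S, 0 ≤ ψ w) (hS : S ∈ 𝓝 0)
    (hγc : ContinuousAt γ 0) (hψc : ContinuousAt ψ 0) (hψi : IntegrableOn ψ S)
    (hmeas : ∀ t, MeasurableSet (weightedTube S γ ℓ t)) (hψpos : 0 < ψ 0) :
    Tendsto (fun t => (∫ w in weightedTube S γ ℓ t, ψ w) / tubeScale m ℓ t) (𝓝[>] 0)
      (𝓝 (tubeCoeff m ℓ * (γ 0)⁻¹ ^ ℓ * ψ 0)) := by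
  have hγpos : 0 < γ 0 := hγ₀.trans_le (hγ 0 (mem_of_mem_nhds hS))
  have hDi : ∀ t, IntegrableOn ψ (weightedTube S γ ℓ t) := fun t =>
    hψi.mono_set fun w hw => hw.1
  have hlim : Tendsto (fun η : ℝ => tubeCoeff m ℓ * (γ 0 + η)⁻¹ ^ ℓ * (ψ 0 - η)) (𝓝 0)
      (𝓝 (tubeCoeff m ℓ * (γ 0)⁻¹ ^ ℓ * ψ 0)) := by
    have : ContinuousAt (fun η : ℝ => tubeCoeff m ℓ * (γ 0 + η)⁻¹ ^ ℓ * (ψ 0 - η)) 0 := by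
      refine ContinuousAt.mul (ContinuousAt.mul continuousAt_const ?_) (by fun_prop)
      refine ContinuousAt.rpow_const (ContinuousAt.inv₀ (by fun_prop) ?_) (Or.inr hℓ.le)
      simpa using hγpos.ne'
    simpa [ContinuousAt] using this
  -- on a small ball all points lie in `S`, and `γ`, `ψ` are within `η` of their values at `0`
  have hball : ∀ η : ℝ, 0 < η → ∃ r, 0 < r ∧ r ≤ R ∧ ∀ w, ‖w‖ ≤ r →
      w ∈ S ∧ γ w ≤ γ 0 + η ∧ γ 0 - η ≤ γ w ∧ ψ w ≤ ψ 0 + η ∧ ψ 0 - η ≤ ψ w := by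
    intro η hη
    have hev : ∀ᶠ w in 𝓝 (0 : Fin m → ℝ),
        w ∈ S ∧ γ w ≤ γ 0 + η ∧ γ 0 - η ≤ γ w ∧ ψ w ≤ ψ 0 + η ∧ ψ 0 - η ≤ ψ w :=
      (eventually_mem_set.2 hS).and <|
        (hγc.eventually_le_const (by linarith)).and <|
        (hγc.eventually_const_le (by linarith)).and <|
        (hψc.eventually_le_const (by linarith)).and <| hψc.eventually_const_le (by linarith)
    obtain ⟨r, hr, hrS⟩ := Metric.nhds_basis_closedBall.mem_iff.1 hev
    exact ⟨min r R, lt_min hr hR, min_le_right _ _, fun w hw =>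
      hrS (mem_closedBall_zero_iff.2 (hw.trans (min_le_left _ _)))⟩
  -- below the limit compare with the tube of weight `γ 0 + η`, above it with that of weight
  -- `γ 0 - η`
  refine tendsto_order.2 ⟨fun b hb => ?_, fun b hb => ?_⟩
  · obtain ⟨η, ⟨hηb, hηψ⟩, hη⟩ := (((hlim.eventually_const_lt hb).and
      (eventually_lt_nhds hψpos)).filter_mono
        (nhdsWithin_le_nhds (s := Set.Ioi 0))).and self_mem_nhdsWithin |>.exists
    replace hη : 0 < η := hη
    obtain ⟨r, hr, -, hrS⟩ := hball η hη
    have hc : 0 < (γ 0 + η)⁻¹ := by positivity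
    have h1 := (tendsto_volume_boxTube_div hm hℓ hr hc).mul_const (ψ 0 - η)
    filter_upwards [h1.eventually_const_lt hηb, eventually_tubeScale_pos m ℓ,
      self_mem_nhdsWithin] with t h2 hN ht
    replace ht : 0 < t := ht
    refine h2.trans_le ?_
    rw [div_mul_eq_mul_div]
    gcongr
    have hsub : boxTube m r (((γ 0 + η)⁻¹ * t) ^ ℓ) ⊆ weightedTube S γ ℓ t := by
      intro w hw
      obtain ⟨hwS, h3, -⟩ := hrS w hw.1
      have := hγ₀.trans_le (hγ w hwS)
      refine ⟨hwS, hw.2.trans ?_⟩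
      gcongr
    calc _ = (ψ 0 - η) * volume.real (boxTube m r (((γ 0 + η)⁻¹ * t) ^ ℓ)) := mul_comm _ _
      _ ≤ ∫ w in boxTube m r (((γ 0 + η)⁻¹ * t) ^ ℓ), ψ w :=
        setIntegral_ge_of_const_le_real (isClosed_boxTube _ _ _).measurableSet
          (volume_boxTube_lt_top _ _ _).ne (fun w hw => (hrS w hw.1).2.2.2.2)
          ((hDi t).mono_set hsub)
      _ ≤ _ := setIntegral_mono_set (hDi t)
          ((ae_restrict_iff' (hmeas t)).2 (ae_of_all _ fun w hw => hψ0 w hw.1))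
          (LE.le.eventuallyLE hsub)
  · have hlim' : Tendsto (fun η : ℝ => tubeCoeff m ℓ * (γ 0 - η)⁻¹ ^ ℓ * (ψ 0 + η)) (𝓝 0)
        (𝓝 (tubeCoeff m ℓ * (γ 0)⁻¹ ^ ℓ * ψ 0)) := by
      have h := hlim.comp (show Tendsto (fun η : ℝ => -η) (𝓝 0) (𝓝 0) by
        simpa using (continuous_neg (G := ℝ)).tendsto 0)
      simpa [Function.comp_def, sub_eq_add_neg] using h
    obtain ⟨η, ⟨hηb, hηγ⟩, hη⟩ := (((hlim'.eventually_lt_const hb).and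
      (eventually_lt_nhds hγpos)).filter_mono
        (nhdsWithin_le_nhds (s := Set.Ioi 0))).and self_mem_nhdsWithin |>.exists
    replace hη : 0 < η := hη
    obtain ⟨r, hr, hrR, hrS⟩ := hball η hη
    have hγη : 0 < γ 0 - η := sub_pos.2 hηγ
    have h1 := ((tendsto_volume_boxTube_div hm hℓ hr (inv_pos.2 hγη)).mul_const (ψ 0 + η)).add
      (tendsto_setIntegral_weightedTube_diff hm hℓ hSR hγ₀ hγ hM hψ hr hrR)
    rw [add_zero] at h1
    filter_upwards [h1.eventually_lt_const hηb, eventually_tubeScale_pos m ℓ,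
      self_mem_nhdsWithin] with t h2 hN ht
    replace ht : 0 < t := ht
    refine lt_of_le_of_lt ?_ h2
    rw [div_mul_eq_mul_div, ← add_div]
    gcongr
    rw [← integral_inter_add_sdiff (Metric.isClosed_closedBall (x := (0 : Fin m → ℝ))
      (ε := r)).measurableSet (hDi t)]
    gcongr
    have hsub : weightedTube S γ ℓ t ∩ Metric.closedBall 0 r ⊆
        boxTube m r (((γ 0 - η)⁻¹ * t) ^ ℓ) := by
      intro w hw
      have hwr := mem_closedBall_zero_iff.1 hw.2
      obtain ⟨hwS, -, h3, -⟩ := hrS w hwr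
      have := hγ₀.trans_le (hγ w hwS)
      refine ⟨hwr, hw.1.2.trans ?_⟩
      gcongr
    have hfin := volume_boxTube_lt_top m r (((γ 0 - η)⁻¹ * t) ^ ℓ)
    calc _ ≤ ‖∫ w in weightedTube S γ ℓ t ∩ Metric.closedBall 0 r, ψ w‖ := Real.le_norm_self _
      _ ≤ (ψ 0 + η) * volume.real (weightedTube S γ ℓ t ∩ Metric.closedBall 0 r) := by
        refine norm_setIntegral_le_of_norm_le_const ((measure_mono hsub).trans_lt hfin)
          fun w hw => ?_
        rw [Real.norm_of_nonneg (hψ0 w hw.1.1)]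
        exact (hrS w (mem_closedBall_zero_iff.1 hw.2)).2.2.2.1
      _ ≤ (ψ 0 + η) * volume.real (boxTube m r (((γ 0 - η)⁻¹ * t) ^ ℓ)) :=
        mul_le_mul_of_nonneg_left (measureReal_mono hsub hfin.ne) (by positivity)
      _ = _ := mul_comm _ _

end WeightedTube

/-! ### Product structure and integrability of powers -/

theorem measurePreserving_append (m n : ℕ) :
    MeasurePreserving (fun p : (Fin m → ℝ) × (Fin n → ℝ) => Fin.append p.1 p.2) := by
  have hmeas : Measurable (fun p : (Fin m → ℝ) × (Fin n → ℝ) => Fin.append p.1 p.2) :=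
    (Fin.appendHomeomorph (X := ℝ) m n).continuous.measurable
  refine ⟨hmeas, ?_⟩
  rw [volume_pi]
  refine (Measure.pi_eq fun s hs => ?_).symm
  rw [Measure.map_apply hmeas (MeasurableSet.univ_pi hs)]
  have : (fun p : (Fin m → ℝ) × (Fin n → ℝ) => Fin.append p.1 p.2) ⁻¹' Set.univ.pi s =
      (Set.univ.pi fun i => s (Fin.castAdd n i)) ×ˢ (Set.univ.pi fun j => s (Fin.natAdd m j)) := by
    ext p
    simp only [Set.mem_preimage, Set.mem_univ_pi, Set.mem_prod]
    refine ⟨fun h => ⟨fun i => by simpa using h (Fin.castAdd n i),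
      fun j => by simpa using h (Fin.natAdd m j)⟩, fun h i => ?_⟩
    refine Fin.addCases (fun i => ?_) (fun j => ?_) i
    · simpa using h.1 i
    · simpa using h.2 j
  rw [this, Measure.volume_eq_prod, Measure.prod_prod, volume_pi_pi, volume_pi_pi,
    Fin.prod_univ_add]

theorem integrableOn_abs_rpow_Icc (R : ℝ) {p : ℝ} (hp : -1 < p) :
    IntegrableOn (fun x : ℝ => |x| ^ p) (Set.Icc (-R) R) := by
  rcases lt_or_ge R 0 with hR | hR
  · rw [Set.Icc_eq_empty (by linarith)]
    exact integrableOn_empty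
  have h : IntervalIntegrable (fun x : ℝ => |x| ^ p) volume (-R) R := by
    refine intervalIntegrable_of_even (by simp) fun x hx => ?_
    refine (intervalIntegrable_congr fun y hy => ?_).1
      (intervalIntegral.intervalIntegrable_rpow' (a := 0) (b := x) hp)
    rw [Set.uIoc_of_le hx.le] at hy
    simp only [abs_of_pos hy.1]
  rw [integrableOn_Icc_iff_integrableOn_Ioc]
  exact (intervalIntegrable_iff_integrableOn_Ioc_of_le (by linarith)).1 h

theorem integrableOn_prod_abs_rpow {ι : Type*} [Fintype ι] {R : ℝ} (hR : 0 ≤ R) {p : ι → ℝ}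
    (hp : ∀ i, -1 < p i) :
    IntegrableOn (fun y : ι → ℝ => ∏ i, |y i| ^ p i) (Metric.closedBall 0 R) := by
  have : Metric.closedBall (0 : ι → ℝ) R = Set.univ.pi fun _ => Set.Icc (-R) R := by
    rw [closedBall_pi _ hR]
    simp [Real.closedBall_eq_Icc]
  rw [IntegrableOn, this, volume_pi, Measure.restrict_pi_pi]
  exact Integrable.fintype_prod (f := fun i x => |x| ^ p i)
    fun i => integrableOn_abs_rpow_Icc R (hp i)

theorem ae_forall_apply_ne_zero (ι : Type*) [Fintype ι] : ∀ᵐ y : ι → ℝ, ∀ i, y i ≠ 0 := by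
  refine ae_all_iff.2 fun i => ?_
  exact (Measure.tendsto_eval_ae_ae (μ := fun _ : ι => (volume : Measure ℝ))).eventually
    (Measure.ae_ne (volume : Measure ℝ) (0 : ℝ))

/-- Solving `|P| ^ k * γ ≤ t` for `|P|`, when `k = 1 / ℓ`. -/
theorem pow_mul_le_iff_le_rpow {k : ℕ} {ℓ : ℝ} (hℓ : 0 < ℓ) (hk : (k : ℝ) = 1 / ℓ) {P γ t : ℝ}
    (hP : 0 ≤ P) (hγ : 0 < γ) (ht : 0 ≤ t) : P ^ k * γ ≤ t ↔ P ≤ (γ⁻¹ * t) ^ ℓ := by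
  have h1 : (P ^ k) ^ ℓ = P := by
    rw [← Real.rpow_natCast, ← Real.rpow_mul hP, hk, one_div_mul_cancel hℓ.ne', Real.rpow_one]
  rw [← le_div_iff₀ hγ, div_eq_inv_mul]
  conv_rhs => rw [← h1]
  exact (Real.rpow_le_rpow_iff (by positivity) (by positivity) hℓ).symm

/-! ### The fibres `ℝ^m × {y}` of the tube -/

theorem continuous_append_left {m n : ℕ} (y : Fin n → ℝ) :
    Continuous fun w : Fin m → ℝ => Fin.append w y :=
  (Fin.appendHomeomorph (X := ℝ) m n).continuous.comp (by fun_prop : Continuous fun w => (w, y))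

theorem norm_le_norm_append_left {m n : ℕ} (w : Fin m → ℝ) (y : Fin n → ℝ) :
    ‖w‖ ≤ ‖Fin.append w y‖ :=
  (pi_norm_le_iff_of_nonneg (norm_nonneg _)).2 fun i => by
    simpa using norm_le_pi_norm (Fin.append w y) (Fin.castAdd n i)

theorem norm_le_norm_append_right {m n : ℕ} (w : Fin m → ℝ) (y : Fin n → ℝ) :
    ‖y‖ ≤ ‖Fin.append w y‖ :=
  (pi_norm_le_iff_of_nonneg (norm_nonneg _)).2 fun j => by
    simpa using norm_le_pi_norm (Fin.append w y) (Fin.natAdd m j)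

theorem inv_prod_pow_mul_rpow {ι : Type*} [Fintype ι] (κ : ι → ℕ) (ℓ : ℝ) {y : ι → ℝ}
    {G : ℝ} (hG : 0 < G) :
    ((∏ j, |y j| ^ κ j) * G)⁻¹ ^ ℓ = (∏ j, |y j| ^ (-(ℓ * (κ j : ℝ)))) * G ^ (-ℓ) := by
  have h0 : 0 ≤ ∏ j, |y j| ^ κ j := Finset.prod_nonneg fun j _ => by positivity
  rw [Real.inv_rpow (by positivity), ← Real.rpow_neg (by positivity), Real.mul_rpow h0 hG.le,
    ← Real.finsetProd_rpow _ _ fun j _ => by positivity]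
  congr 1
  refine Finset.prod_congr rfl fun j _ => ?_
  rw [← Real.rpow_natCast, ← Real.rpow_mul (abs_nonneg _)]
  congr 1
  ring

/-- The part of the tube `{|f| ≤ t} ⊆ Ω` on the fibre `ℝ^m × {y}`. -/
def tubeFibre (m n : ℕ) (Ω : Set (Fin (m + n) → ℝ)) (f : (Fin (m + n) → ℝ) → ℝ) (t : ℝ)
    (y : Fin n → ℝ) : Set (Fin m → ℝ) :=
  {w | Fin.append w y ∈ Ω ∧ |f (Fin.append w y)| ≤ t}

section Fibre

variable {m n : ℕ} {Ω : Set (Fin (m + n) → ℝ)} {f g φ : (Fin (m + n) → ℝ) → ℝ}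
  {κ : Fin (m + n) → ℕ} {ℓ : ℝ}

theorem isClosed_sublevel (hΩ : IsCompact Ω) (hf : ContinuousOn f Ω) (t : ℝ) :
    IsClosed {ω | ω ∈ Ω ∧ |f ω| ≤ t} :=
  hf.abs.preimage_isClosed_of_isClosed hΩ.isClosed isClosed_Iic

theorem continuousOn_monomialTimes (hg : ContinuousOn g Ω) :
    ContinuousOn (monomialTimes κ g) Ω :=
  ContinuousOn.mul (Continuous.continuousOn (by fun_prop)) hg

theorem measurableSet_tubeFibre (hΩ : IsCompact Ω) (hf : ContinuousOn f Ω) (t : ℝ)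
    (y : Fin n → ℝ) : MeasurableSet (tubeFibre m n Ω f t y) :=
  ((isClosed_sublevel hΩ hf t).preimage (continuous_append_left y)).measurableSet

/-- Fubini's theorem for the tube volume. -/
theorem integrable_and_tubeVolume_eq (hΩ : IsCompact Ω) (hf : ContinuousOn f Ω)
    (hφ : ContinuousOn φ Ω) (t : ℝ) :
    Integrable (fun y => ∫ w in tubeFibre m n Ω f t y, φ (Fin.append w y)) ∧
      tubeVolume Ω f φ t = ∫ y, ∫ w in tubeFibre m n Ω f t y, φ (Fin.append w y) := by
  set D := {ω | ω ∈ Ω ∧ |f ω| ≤ t}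
  have hD : MeasurableSet D := (isClosed_sublevel hΩ hf t).measurableSet
  have hi : Integrable (D.indicator φ) :=
    (integrable_indicator_iff hD).2 ((hφ.integrableOn_compact hΩ).mono_set fun _ h => h.1)
  have hemb : MeasurableEmbedding fun p : (Fin m → ℝ) × (Fin n → ℝ) => Fin.append p.1 p.2 :=
    (Fin.appendHomeomorph (X := ℝ) m n).measurableEmbedding
  have hmp := measurePreserving_append m n
  have hi' : Integrable (fun p : (Fin m → ℝ) × (Fin n → ℝ) => D.indicator φ (Fin.append p.1 p.2))
      (volume.prod volume) := (hmp.integrable_comp_emb hemb).2 hi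
  have hfib : ∀ y, ∫ w, D.indicator φ (Fin.append w y) =
      ∫ w in tubeFibre m n Ω f t y, φ (Fin.append w y) := fun y => by
    rw [← integral_indicator (measurableSet_tubeFibre hΩ hf t y)]
    rfl
  simp_rw [← hfib]
  refine ⟨hi'.integral_prod_right, ?_⟩
  rw [tubeVolume, ← integral_indicator hD, ← hmp.integral_comp hemb, Measure.volume_eq_prod,
    integral_prod_symm _ hi']

theorem tubeFibre_eq_weightedTube (hgpos : ∀ ω ∈ Ω, 0 < g ω) (hℓ : 0 < ℓ)
    (hκ : ∀ i : Fin m, (κ (Fin.castAdd n i) : ℝ) = 1 / ℓ) {y : Fin n → ℝ} (hy : ∀ j, y j ≠ 0)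
    {t : ℝ} (hm : 1 ≤ m) (ht : 0 ≤ t) :
    tubeFibre m n Ω (monomialTimes κ g) t y =
      weightedTube {w | Fin.append w y ∈ Ω}
        (fun w => (∏ j, |y j| ^ κ (Fin.natAdd m j)) * g (Fin.append w y)) ℓ t := by
  ext w
  refine and_congr_right fun hw => ?_
  have ha : 0 < ∏ j, |y j| ^ κ (Fin.natAdd m j) :=
    Finset.prod_pos fun j _ => pow_pos (abs_pos.2 (hy j)) _
  have hG := hgpos _ hw
  have hk : ∀ i : Fin m, κ (Fin.castAdd n i) = κ (Fin.castAdd n ⟨0, hm⟩) := fun i => by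
    exact_mod_cast (hκ i).trans (hκ ⟨0, hm⟩).symm
  rw [← pow_mul_le_iff_le_rpow hℓ (hκ ⟨0, hm⟩) (abs_nonneg _) (mul_pos ha hG) ht]
  simp only [monomialTimes, Fin.prod_univ_add, Fin.append_left, Fin.append_right, abs_mul,
    Finset.abs_prod, abs_pow, abs_of_pos hG, hk, Finset.prod_pow, mul_assoc]

theorem exists_pos_forall_le (hΩ : IsCompact Ω) (hg : ContinuousOn g Ω)
    (hgpos : ∀ ω ∈ Ω, 0 < g ω) : ∃ g₀, 0 < g₀ ∧ ∀ ω ∈ Ω, g₀ ≤ g ω := by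
  rcases Ω.eq_empty_or_nonempty with rfl | hne
  · exact ⟨1, one_pos, by simp⟩
  · obtain ⟨x, hx, hmin⟩ := hΩ.exists_isMinOn hne hg
    exact ⟨g x, hgpos x hx, fun ω hω => hmin hω⟩

theorem exists_nonneg_forall_norm_le (hΩ : IsCompact Ω) (hφ : ContinuousOn φ Ω) :
    ∃ M, 0 ≤ M ∧ ∀ ω ∈ Ω, ‖φ ω‖ ≤ M := by
  obtain ⟨M, hM⟩ := hΩ.exists_bound_of_continuousOn hφ
  exact ⟨max M 0, le_max_right _ _, fun ω hω => (hM ω hω).trans (le_max_left _ _)⟩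

/-- The pointwise limit over `y`: the point `(0, y)` is either interior to `Ω` or has a
neighbourhood disjoint from `Ω`, and the limit of the normalised fibre integral is the corresponding value. -/
theorem tendsto_setIntegral_tubeFibre (hm : 1 ≤ m) (hΩ : IsCompact Ω) (hg : ContinuousOn g Ω)
    (hφ : ContinuousOn φ Ω) (hgpos : ∀ ω ∈ Ω, 0 < g ω) (hφpos : ∀ ω ∈ Ω, 0 < φ ω) (hℓ : 0 < ℓ)
    (hκ : ∀ i : Fin m, (κ (Fin.castAdd n i) : ℝ) = 1 / ℓ) {y : Fin n → ℝ} (hy : ∀ j, y j ≠ 0)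
    (hyf : zeroAppend m n y ∉ frontier Ω) :
    Tendsto (fun t => (∫ w in tubeFibre m n Ω (monomialTimes κ g) t y, φ (Fin.append w y)) /
      tubeScale m ℓ t) (𝓝[>] 0)
      (𝓝 ((coordSlice m n Ω).indicator
        (fun y => tubeCoeff m ℓ * sliceIntegrand m n κ ℓ g φ y) y)) := by
  obtain ⟨R, hR, hΩR⟩ := hΩ.isBounded.exists_pos_norm_le
  obtain ⟨g₀, hg₀, hgg₀⟩ := exists_pos_forall_le hΩ hg hgpos
  obtain ⟨M, hM, hφM⟩ := exists_nonneg_forall_norm_le hΩ hφ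
  set a := ∏ j, |y j| ^ κ (Fin.natAdd m j) with ha_def
  have ha : 0 < a := Finset.prod_pos fun j _ => pow_pos (abs_pos.2 (hy j)) _
  set S : Set (Fin m → ℝ) := {w | Fin.append w y ∈ Ω} with hS_def
  have hcont := continuous_append_left (m := m) y
  have heq : ∀ t, 0 ≤ t → tubeFibre m n Ω (monomialTimes κ g) t y =
      weightedTube S (fun w => a * g (Fin.append w y)) ℓ t := fun t ht =>
    tubeFibre_eq_weightedTube hgpos hℓ hκ hy hm ht
  have hcongr : (fun t => (∫ w in weightedTube S (fun w => a * g (Fin.append w y)) ℓ t,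
      φ (Fin.append w y)) / tubeScale m ℓ t) =ᶠ[𝓝[>] 0]
      fun t => (∫ w in tubeFibre m n Ω (monomialTimes κ g) t y, φ (Fin.append w y)) /
        tubeScale m ℓ t := by
    filter_upwards [self_mem_nhdsWithin] with t ht
    rw [heq t (le_of_lt ht)]
  refine Tendsto.congr' hcongr ?_
  have hSR : ∀ w ∈ S, ‖w‖ ≤ R := fun w hw => (norm_le_norm_append_left w y).trans (hΩR _ hw)
  have hγ : ∀ w ∈ S, a * g₀ ≤ a * g (Fin.append w y) := fun w hw =>
    mul_le_mul_of_nonneg_left (hgg₀ _ hw) ha.le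
  have hψ : ∀ w ∈ S, ‖φ (Fin.append w y)‖ ≤ M := fun w hw => hφM _ hw
  by_cases hyS : y ∈ coordSlice m n Ω
  · rw [Set.indicator_of_mem hyS]
    have hint : Ω ∈ 𝓝 (Fin.append (0 : Fin m → ℝ) y) := by
      rw [← mem_interior_iff_mem_nhds]
      by_contra h
      exact hyf ⟨subset_closure hyS, h⟩
    have hSc : IsCompact S := (Metric.isCompact_iff_isClosed_bounded).2
      ⟨hΩ.isClosed.preimage hcont,
        (Metric.isBounded_closedBall (x := 0) (r := R)).subset fun w hw =>
          mem_closedBall_zero_iff.2 (hSR w hw)⟩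
    have hψi : IntegrableOn (fun w => φ (Fin.append w y)) S :=
      (hφ.comp hcont.continuousOn fun w hw => hw).integrableOn_compact hSc
    have hmeas : ∀ t, MeasurableSet (weightedTube S (fun w => a * g (Fin.append w y)) ℓ t) := by
      intro t
      have hc : ContinuousOn (fun w : Fin m → ℝ =>
          |∏ i, w i| - ((a * g (Fin.append w y))⁻¹ * t) ^ ℓ) S := by
        refine ContinuousOn.sub (Continuous.continuousOn (by fun_prop)) ?_
        refine ContinuousOn.rpow_const ?_ fun w _ => Or.inr hℓ.le
        refine ContinuousOn.mul (ContinuousOn.inv₀ ?_ fun w hw => ?_) continuousOn_const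
        · exact continuousOn_const.mul (hg.comp hcont.continuousOn fun w hw => hw)
        · exact (mul_pos ha (hgpos _ hw)).ne'
      have h := hc.preimage_isClosed_of_isClosed hSc.isClosed (isClosed_Iic (a := 0))
      have hset : weightedTube S (fun w => a * g (Fin.append w y)) ℓ t = S ∩ (fun w : Fin m → ℝ =>
          |∏ i, w i| - ((a * g (Fin.append w y))⁻¹ * t) ^ ℓ) ⁻¹' Set.Iic 0 := by
        ext w
        simp [weightedTube]
      rw [hset]
      exact h.measurableSet
    have h := tendsto_setIntegral_weightedTube_of_mem hm hℓ hSR hR (mul_pos ha hg₀) hγ hM hψ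
      (fun w hw => (hφpos _ hw).le) (hcont.continuousAt hint)
      (ContinuousAt.mul continuousAt_const
        ((hg.continuousAt hint).comp (f := fun w => Fin.append w y) hcont.continuousAt))
      ((hφ.continuousAt hint).comp (f := fun w => Fin.append w y) hcont.continuousAt)
      hψi hmeas (hφpos _ hyS)
    rw [inv_prod_pow_mul_rpow _ ℓ (hgpos _ hyS)] at h
    rw [sliceIntegrand, ← mul_assoc]
    exact h
  · rw [Set.indicator_of_notMem hyS]
    exact tendsto_setIntegral_weightedTube_of_notMem hm hℓ hSR hR (mul_pos ha hg₀) hγ hM hψ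
      (hcont.continuousAt (hΩ.isClosed.isOpen_compl.mem_nhds hyS))

/-- The integrable majorant of the normalised fibre integrals. It comes from replacing `g` by a
positive lower bound and `φ` by an upper bound. -/
theorem exists_norm_setIntegral_tubeFibre_le (hm : 1 ≤ m) (hΩ : IsCompact Ω)
    (hg : ContinuousOn g Ω) (hφ : ContinuousOn φ Ω) (hgpos : ∀ ω ∈ Ω, 0 < g ω) (hℓ : 0 < ℓ)
    (hκ : ∀ i : Fin m, (κ (Fin.castAdd n i) : ℝ) = 1 / ℓ) :
    ∃ R K : ℝ, 0 < R ∧ ∀ᶠ t in 𝓝[>] (0 : ℝ), ∀ y : Fin n → ℝ, (∀ j, y j ≠ 0) →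
      ‖(∫ w in tubeFibre m n Ω (monomialTimes κ g) t y, φ (Fin.append w y)) / tubeScale m ℓ t‖ ≤
        (Metric.closedBall 0 R).indicator
          (fun y => K * ∏ j, |y j| ^ (-(ℓ * (κ (Fin.natAdd m j) : ℝ)))) y := by
  obtain ⟨R, hR, hΩR⟩ := hΩ.isBounded.exists_pos_norm_le
  obtain ⟨g₀, hg₀, hgg₀⟩ := exists_pos_forall_le hΩ hg hgpos
  obtain ⟨M, hM, hφM⟩ := exists_nonneg_forall_norm_le hΩ hφ
  obtain ⟨A, hA⟩ := (isCompact_closedBall (0 : Fin n → ℝ) R).exists_bound_of_continuousOn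
    (f := fun y => ∏ j, |y j| ^ κ (Fin.natAdd m j)) (Continuous.continuousOn (by fun_prop))
  have hA' : 0 < max A 1 := lt_max_of_lt_right one_pos
  obtain ⟨K, hK, hvol⟩ := volume_boxTube_le hm hℓ hR (inv_pos.2 (mul_pos hA' hg₀))
  refine ⟨R, M * K * g₀ ^ (-ℓ), hR, ?_⟩
  filter_upwards [hvol, eventually_tubeScale_pos m ℓ, self_mem_nhdsWithin] with t hvt hN ht y hy
  replace ht : 0 < t := ht
  set a := ∏ j, |y j| ^ κ (Fin.natAdd m j) with ha_def
  have ha : 0 < a := Finset.prod_pos fun j _ => pow_pos (abs_pos.2 (hy j)) _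
  by_cases hyR : y ∈ Metric.closedBall (0 : Fin n → ℝ) R
  · rw [Set.indicator_of_mem hyR, norm_div, Real.norm_of_nonneg hN.le, div_le_iff₀ hN,
      tubeFibre_eq_weightedTube hgpos hℓ hκ hy hm ht.le]
    have haA : a ≤ max A 1 := ((Real.le_norm_self _).trans (hA y hyR)).trans (le_max_left _ _)
    calc _ ≤ M * volume.real (boxTube m R (((a * g₀)⁻¹ * t) ^ ℓ)) :=
        norm_setIntegral_weightedTube_le hℓ
          (fun w hw => (norm_le_norm_append_left w y).trans (hΩR _ hw)) (mul_pos ha hg₀)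
          (fun w hw => mul_le_mul_of_nonneg_left (hgg₀ _ hw) ha.le) hM (fun w hw => hφM _ hw) ht
      _ ≤ M * (K * (a * g₀)⁻¹ ^ ℓ * tubeScale m ℓ t) := by
        gcongr
        exact hvt _ (by gcongr)
      _ = _ := by
        rw [ha_def, inv_prod_pow_mul_rpow _ ℓ hg₀]
        ring
  · have : tubeFibre m n Ω (monomialTimes κ g) t y = ∅ := by
      refine Set.eq_empty_of_forall_notMem fun w hw => hyR (mem_closedBall_zero_iff.2 ?_)
      exact (norm_le_norm_append_right w y).trans (hΩR _ hw.1)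
    rw [this, Set.indicator_of_notMem hyR]
    simp

/-! ### Integration over `y` -/

theorem neg_one_lt_neg_mul {ℓ k : ℝ} (hℓ : 0 < ℓ) (hk : k < 1 / ℓ) : -1 < -(ℓ * k) := by
  rw [lt_div_iff₀ hℓ] at hk
  linarith

theorem isCompact_coordSlice (hΩ : IsCompact Ω) : IsCompact (coordSlice m n Ω) := by
  obtain ⟨R, hR, hΩR⟩ := hΩ.isBounded.exists_pos_norm_le
  refine (Metric.isCompact_iff_isClosed_bounded).2
    ⟨hΩ.isClosed.preimage (zeroAppend m n).continuous,
      (Metric.isBounded_closedBall (x := 0) (r := R)).subset fun y hy => ?_⟩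
  exact mem_closedBall_zero_iff.2 ((norm_le_norm_append_right 0 y).trans (hΩR _ hy))

theorem integrableOn_sliceIntegrand (hΩ : IsCompact Ω) (hg : ContinuousOn g Ω)
    (hφ : ContinuousOn φ Ω) (hgpos : ∀ ω ∈ Ω, 0 < g ω) (hℓ : 0 < ℓ)
    (hκ' : ∀ j : Fin n, (κ (Fin.natAdd m j) : ℝ) < 1 / ℓ) :
    IntegrableOn (sliceIntegrand m n κ ℓ g φ) (coordSlice m n Ω) := by
  have hc := isCompact_coordSlice (m := m) (n := n) hΩ
  obtain ⟨R, hR, hcR⟩ := hc.isBounded.exists_pos_norm_le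
  have h1 := (integrableOn_prod_abs_rpow hR.le fun j => neg_one_lt_neg_mul hℓ (hκ' j)).mono_set
    fun y hy => mem_closedBall_zero_iff.2 (hcR y hy)
  have hz := (zeroAppend m n).continuous
  refine (h1.mul_continuousOn ?_ hc).mul_continuousOn ?_ hc
  · exact (hg.comp hz.continuousOn fun y hy => hy).rpow_const fun y hy => Or.inl (hgpos _ hy).ne'
  · exact hφ.comp hz.continuousOn fun y hy => hy

/-- Dominated convergence over `y ∈ ℝⁿ`. The boundary of `Ω` enters only through the null set of
those `y` for which `(0, y)` lies on it. -/
theorem tendsto_tubeVolume_div (hm : 1 ≤ m) (hΩ : IsCompact Ω) (hg : ContinuousOn g Ω)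
    (hφ : ContinuousOn φ Ω) (hgpos : ∀ ω ∈ Ω, 0 < g ω) (hφpos : ∀ ω ∈ Ω, 0 < φ ω) (hℓ : 0 < ℓ)
    (hκ : ∀ i : Fin m, (κ (Fin.castAdd n i) : ℝ) = 1 / ℓ)
    (hκ' : ∀ j : Fin n, (κ (Fin.natAdd m j) : ℝ) < 1 / ℓ)
    (hnull : volume {y | zeroAppend m n y ∈ frontier Ω} = 0) :
    Tendsto (fun t => tubeVolume Ω (monomialTimes κ g) φ t / tubeScale m ℓ t) (𝓝[>] 0)
      (𝓝 (tubeConstant m n Ω κ ℓ g φ)) := by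
  have hconst : tubeConstant m n Ω κ ℓ g φ = ∫ y, (coordSlice m n Ω).indicator
      (fun y => tubeCoeff m ℓ * sliceIntegrand m n κ ℓ g φ y) y := by
    rw [integral_indicator (isCompact_coordSlice hΩ).measurableSet, integral_const_mul,
      tubeConstant, tubeCoeff]
    congr 1
    -- one factor of `ℓ ^ m` cancels against the denominator
    obtain ⟨k, rfl⟩ := Nat.exists_eq_add_of_le' hm
    rw [Nat.add_sub_cancel, mul_pow, pow_succ ℓ]
    field_simp
  have hf := continuousOn_monomialTimes (κ := κ) hg
  have hvol : ∀ t, tubeVolume Ω (monomialTimes κ g) φ t / tubeScale m ℓ t =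
      ∫ y, (∫ w in tubeFibre m n Ω (monomialTimes κ g) t y, φ (Fin.append w y)) /
        tubeScale m ℓ t := fun t => by
    rw [integral_div, (integrable_and_tubeVolume_eq hΩ hf hφ t).2]
  obtain ⟨R, K, hR, hbound⟩ := exists_norm_setIntegral_tubeFibre_le hm hΩ hg hφ hgpos hℓ hκ
  simp_rw [hvol]
  rw [hconst]
  refine tendsto_integral_filter_of_dominated_convergence _
    (Eventually.of_forall fun t =>
      ((integrable_and_tubeVolume_eq hΩ hf hφ t).1.div_const _).aestronglyMeasurable)
    (hbound.mono fun t ht => (ae_forall_apply_ne_zero (Fin n)).mono fun y hy => ht y hy) ?_ ?_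
  · rw [integrable_indicator_iff Metric.isClosed_closedBall.measurableSet]
    exact (integrableOn_prod_abs_rpow hR.le fun j => neg_one_lt_neg_mul hℓ (hκ' j)).const_mul K
  · filter_upwards [ae_forall_apply_ne_zero (Fin n), measure_eq_zero_iff_ae_notMem.1 hnull]
      with y hy hyf
    exact tendsto_setIntegral_tubeFibre hm hΩ hg hφ hgpos hφpos hℓ hκ hy hyf

theorem tubeConstant_pos (hΩ : IsCompact Ω) (hg : ContinuousOn g Ω)
    (hφ : ContinuousOn φ Ω) (hgpos : ∀ ω ∈ Ω, 0 < g ω) (hφpos : ∀ ω ∈ Ω, 0 < φ ω) (hℓ : 0 < ℓ)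
    (hκ' : ∀ j : Fin n, (κ (Fin.natAdd m j) : ℝ) < 1 / ℓ)
    (hne : (interior Ω ∩ (coordSubspace m n : Set (Fin (m + n) → ℝ))).Nonempty) :
    0 < tubeConstant m n Ω κ ℓ g φ := by
  refine mul_pos (by positivity) ?_
  have hms : MeasurableSet (coordSlice m n Ω) := (isCompact_coordSlice hΩ).measurableSet
  rw [setIntegral_pos_iff_support_of_nonneg_ae _
    (integrableOn_sliceIntegrand hΩ hg hφ hgpos hℓ hκ')]
  · obtain ⟨x, hx, hxL⟩ := hne
    obtain ⟨y, rfl⟩ := exists_zeroAppend_eq hxL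
    have hU : IsOpen (zeroAppend m n ⁻¹' interior Ω) :=
      isOpen_interior.preimage (zeroAppend m n).continuous
    refine (hU.measure_pos volume ⟨y, hx⟩).trans_le (measure_mono_ae ?_)
    filter_upwards [ae_forall_apply_ne_zero (Fin n)] with z hz hzU
    have hzΩ : Fin.append (0 : Fin m → ℝ) z ∈ Ω := interior_subset hzU
    refine ⟨ne_of_gt ?_, hzΩ⟩
    refine mul_pos (mul_pos (Finset.prod_pos fun j _ => ?_) ?_) (hφpos _ hzΩ)
    · exact Real.rpow_pos_of_pos (abs_pos.2 (hz j)) _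
    · exact Real.rpow_pos_of_pos (hgpos _ hzΩ) _
  · refine (ae_restrict_iff' hms).2 (ae_of_all _ fun z hz => ?_)
    refine mul_nonneg (mul_nonneg (Finset.prod_nonneg fun j _ => by positivity) ?_)
      (hφpos _ hz).le
    exact Real.rpow_nonneg (hgpos _ hz).le _

end Fibre

theorem mainTheorem8 (m n : ℕ) (hm : 1 ≤ m) (Ω : Set (Fin (m + n) → ℝ)) (hΩ : IsCompact Ω)
    (g φ : (Fin (m + n) → ℝ) → ℝ)
    (hg : ContinuousOn g Ω) (hφ : ContinuousOn φ Ω)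
    (hgpos : ∀ ω ∈ Ω, 0 < g ω) (hφpos : ∀ ω ∈ Ω, 0 < φ ω)
    (κ : Fin (m + n) → ℕ) (ℓ : ℝ) (hℓ : 0 < ℓ)
    (hκ : ∀ i : Fin m, (κ (Fin.castAdd n i) : ℝ) = 1 / ℓ)
    (hκ' : ∀ j : Fin n, (κ (Fin.natAdd m j) : ℝ) < 1 / ℓ)
    (htrans : BoundaryTransversal Ω (coordSubspace m n)) :
    IntegrableOn (sliceIntegrand m n κ ℓ g φ) (coordSlice m n Ω) ∧
    (fun t : ℝ => tubeVolume Ω (monomialTimes κ g) φ t -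
        tubeConstant m n Ω κ ℓ g φ * t ^ ℓ * (-Real.log t) ^ (m - 1))
      =o[𝓝[>] 0] (fun t : ℝ => t ^ ℓ * (-Real.log t) ^ (m - 1)) ∧
    ((interior Ω ∩ (coordSubspace m n : Set (Fin (m + n) → ℝ))).Nonempty →
      0 < tubeConstant m n Ω κ ℓ g φ ∧
      (fun t : ℝ => tubeVolume Ω (monomialTimes κ g) φ t) ~[𝓝[>] 0]
        (fun t : ℝ => tubeConstant m n Ω κ ℓ g φ * t ^ ℓ * (-Real.log t) ^ (m - 1))) := by
  set C := tubeConstant m n Ω κ ℓ g φ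
  have hlim := tendsto_tubeVolume_div hm hΩ hg hφ hgpos hφpos hℓ hκ hκ'
    htrans.volume_preimage_frontier_eq_zero
  have ho : (fun t : ℝ => tubeVolume Ω (monomialTimes κ g) φ t -
        C * t ^ ℓ * (-Real.log t) ^ (m - 1))
      =o[𝓝[>] 0] (fun t : ℝ => t ^ ℓ * (-Real.log t) ^ (m - 1)) := by
    have hN := eventually_tubeScale_pos m ℓ
    refine (isLittleO_iff_tendsto' (hN.mono fun t ht h0 => absurd h0 ht.ne')).2 ?_
    have h0 : Tendsto (fun t => tubeVolume Ω (monomialTimes κ g) φ t / tubeScale m ℓ t - C)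
        (𝓝[>] 0) (𝓝 0) := by
      have h := hlim.sub_const C
      rwa [sub_self C] at h
    refine h0.congr' (hN.mono fun t ht => ?_)
    dsimp only
    rw [mul_assoc, sub_div]
    exact congrArg _ (mul_div_cancel_right₀ C ht.ne').symm
  refine ⟨integrableOn_sliceIntegrand hΩ hg hφ hgpos hℓ hκ', ho, fun hne => ?_⟩
  have hC : 0 < C := tubeConstant_pos hΩ hg hφ hgpos hφpos hℓ hκ' hne
  refine ⟨hC, ?_⟩
  simp only [mul_assoc] at ho ⊢
  exact (isLittleO_const_mul_right_iff hC.ne').2 ho
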